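/- **Setting.** $\mathsf N$ nodes $n_1,\dots,n_{\mathsf N}$ (indices modulo $\mathsf N$) lie on a ring, and a message broadcast by a node is received by all nodes at ring distance at most $d$ from it. There are $\mathsf N$ files; under the *cyclic placement* with computation load $r$, node $n_k$ caches files $w_k,w_{k+1},\dots,w_{k+r-1}$. From each file $w_i$ one computes, by given map functions, intermediate values $v_i^1,\dots,v_i^{\mathsf N}$, each a packet of $\mathsf B\ge 1$ symbols of a finite field $\mathbb F_q$. At each clock tick every node broadcasts some number of symbols of $\mathbb F_q$ (a number fixed in advance, possibly zero) that are a function of the intermediate values of its own cached files and of everything it has received before. In the *all-to-all* problem each node $n_k$ must finally recover $v_1^k,\dots,v_{\mathsf N}^k$ from its local intermediate values and its received messages, whatever the map functions and the files are. The *normalized communication load* (NCL) of a scheme is the total number of broadcast symbols divided by $\mathsf N\mathsf B$, and it is *achievable* if the scheme solves the problem. **Theorem.** For $1\le r\le\mathsf N$ and $1\le d\le\lfloor \mathsf N/2\rfloor$ put $$ E(\mathsf N,r,d)=\begin{cases} \dfrac{\mathsf N}{4d}\Big(\dfrac{\mathsf N}{2}-r\Big)+\dfrac{\mathsf N-r}{4}+\dfrac{r^2}{8d},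 & d\le r-1,\\[2mm] \dfrac{\mathsf N}{4d}\Big(\dfrac{\mathsf N}{2}-3r\Big)+\dfrac{3\mathsf N-5r}{4}+\dfrac{9r^2+4(\mathsf N-r+1)}{8d}, & r-1<d\le 2(r-1),\\[2mm] \dfrac{\mathsf N}{4d}\Big(\dfrac{\mathsf N}{2}-r\Big)+\dfrac{3(\mathsf N-r)}{4}+\dfrac{r^2}{8d}, & d\ge 2r-1. \end{cases} $$ There is an absolute constant $C>0$ such that for all such $\mathsf N,r,d$, every finite field $\mathbb F_q$ and every packet size $\mathsf B\ge1$, the cyclic placement has computation load $r$ (the total number of cached files divided by $\mathsf N$), and under it some all-to-all NCL $\mathsf T$ is achievable with $$ \mathsf T\le C\,E(\mathsf N,r,d)\qquad\text{and}\qquad \mathsf T\le E(\mathsf N,r,d)+C\Big(d+\frac{\mathsf N}{d\,\mathsf B}\Big). $$ That is, $\mathsf T=O(E(\mathsf N,r,d))$; moreover the bound holds with constant $1$ in front of $E$ up to the displayed remainder, whose second term vanishes as $\mathsf B\to\infty$. -/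

import Mathlib

namespace RingComputing

/-- The nodes whose broadcasts reach node `k`: those at distance at least `1` and at most `d` from
`k` along the ring. Nodes, files and output functions are all indexed by `ZMod N`. -/
def neighbors (N d : ℕ) (k : ZMod N) : Set (ZMod N) :=
  {m | ∃ s : ℕ, 1 ≤ s ∧ s ≤ d ∧ (m = k + (s : ZMod N) ∨ m = k - (s : ZMod N))}

/-- Cyclic placement: node `k` caches the files `k, k + 1, …, k + r - 1`. -/
def cyclicPlacement (N r : ℕ) (k : ZMod N) : Finset (ZMod N) :=
  (Finset.range r).image fun s : ℕ => k + (s : ZMod N)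

/-- Computation load of a placement: the total number of cached files divided by `N`. -/
noncomputable def computationLoad (N : ℕ) [NeZero N] (M : ZMod N → Finset (ZMod N)) : ℝ :=
  (∑ k, ((M k).card : ℝ)) / N

/-- An array of intermediate values: `v i j` is the intermediate value computed from file `i` for
node `j`, a packet of `B` symbols of the field `K`. -/
abbrev IVArray (N B : ℕ) (K : Type*) := ZMod N → ZMod N → Fin B → K

/-- The intermediate values that node `k` computes locally. -/
abbrev LocalIVs (N B : ℕ) (K : Type*) (M : ZMod N → Finset (ZMod N)) (k : ZMod N) :=
  {i // i ∈ M k} → ZMod N → Fin B → K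

/-- What node `k` receives during the first `t` clock ticks, when node `m` broadcasts
`len s m` symbols at clock tick `s`. -/
abbrev Received (N d : ℕ) (K : Type*) (len : ℕ → ZMod N → ℕ) (t : ℕ) (k : ZMod N) :=
  (s : Fin t) → (m : {m // m ∈ neighbors N d k}) → Fin (len s m) → K

/-- A coding scheme for all-to-all computing on the ring with `N` nodes, broadcast distance `d` and
file placement `M`. The clock ticks are `0, …, ticks - 1`. -/
structure Scheme (N d B : ℕ) (K : Type*) (M : ZMod N → Finset (ZMod N)) where
  /-- the number of clock ticks -/
  ticks : ℕ
  /-- `len t k` is the number of symbols broadcast by node `k` at clock tick `t` -/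
  len : ℕ → ZMod N → ℕ
  /-- the encoding functions, of the local intermediate values and of all earlier receptions -/
  enc : (t : ℕ) → (k : ZMod N) → LocalIVs N B K M k → Received N d K len t k → Fin (len t k) → K
  /-- the decoding functions; `dec k _ _ i` is the estimate of the intermediate value computed from
  file `i` for node `k` -/
  dec : (k : ZMod N) → LocalIVs N B K M k → Received N d K len ticks k → ZMod N → Fin B → K

namespace Scheme

/-- The message broadcast by node `k` at clock tick `t`, when the intermediate values are `v`. -/
def msg {N d B : ℕ} {K : Type*} {M : ZMod N → Finset (ZMod N)} (S : Scheme N d B K M)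
    (v : IVArray N B K) (t : ℕ) (k : ZMod N) : Fin (S.len t k) → K :=
  S.enc t k (fun i => v i.1) (fun s m => S.msg v s.1 m.1)
termination_by t
decreasing_by exact s.isLt

/-- The intermediate values that node `k` recovers at the end. -/
def decoded {N d B : ℕ} {K : Type*} {M : ZMod N → Finset (ZMod N)} (S : Scheme N d B K M)
    (v : IVArray N B K) (k : ZMod N) : ZMod N → Fin B → K :=
  S.dec k (fun i => v i.1) (fun s m => S.msg v s.1 m.1)

/-- The scheme solves the all-to-all problem: whatever the map functions `g` and the files `w` are,
every node `k` recovers the intermediate values for it from all the files. -/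
def Solves {N d B : ℕ} {K : Type*} {M : ZMod N → Finset (ZMod N)} (S : Scheme N d B K M) : Prop :=
  ∀ (L : ℕ) (g : ZMod N → (Fin L → K) → ZMod N → Fin B → K) (w : ZMod N → Fin L → K)
    (k i : ZMod N), S.decoded (fun i j => g i (w i) j) k i = g i (w i) k

/-- Normalized communication load: the total number of broadcast symbols divided by `N * B`. -/
noncomputable def ncl {N d B : ℕ} [NeZero N] {K : Type*} {M : ZMod N → Finset (ZMod N)}
    (S : Scheme N d B K M) : ℝ :=
  (∑ t ∈ Finset.range S.ticks, ∑ k, (S.len t k : ℝ)) / (N * B)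

end Scheme

/-- `T` is the normalized communication load of some scheme solving the all-to-all problem, with
broadcast distance `d`, packets of `B` symbols of `K`, and placement `M`. -/
def AchievableNCL (N d B : ℕ) [NeZero N] (K : Type*) (M : ZMod N → Finset (ZMod N)) (T : ℝ) :
    Prop :=
  ∃ S : Scheme N d B K M, S.Solves ∧ S.ncl = T

/-- The three explicit expressions, for `d ≤ r - 1`, `r - 1 < d ≤ 2 (r - 1)` and `2 r - 1 ≤ d`. -/
noncomputable def loadExpr (N r d : ℕ) : ℝ :=
  if (d : ℤ) ≤ r - 1 then
    (N : ℝ) / (4 * d) * ((N : ℝ) / 2 - r) + ((N : ℝ) - r) / 4 + (r : ℝ) ^ 2 / (8 * d)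
  else if (d : ℤ) ≤ 2 * (r - 1) then
    (N : ℝ) / (4 * d) * ((N : ℝ) / 2 - 3 * r) + (3 * (N : ℝ) - 5 * r) / 4
      + (9 * (r : ℝ) ^ 2 + 4 * ((N : ℝ) - r + 1)) / (8 * d)
  else
    (N : ℝ) / (4 * d) * ((N : ℝ) / 2 - r) + 3 * ((N : ℝ) - r) / 4 + (r : ℝ) ^ 2 / (8 * d)

end RingComputing

/-!
Write `n = N - r`. Node `k` lacks `n` packets, of the files `k + r, …, k - 1`; for `0 ≤ j < n`,
file `k + r + j` has its nearest holders at distance `j + 1` above and `n - j` below `k`. Numbering the `n B` missing symbols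
`0, 1, …` in this order, the first half comes down the ring and the second half comes up, and the
`u`-th symbol from either end has to travel the distance `u / B + 1`. These two symbols form the
stream `u`, for `u < ⌈n B / 2⌉`. It needs `⌈(u / B + 1) / d⌉ = u / (B d) + 1` hops of length at most `d`,
and in every hop a node broadcasts the *sum* of the downward and the upward symbol that it relays.

A receiver can separate the sum because the summand that moves away from it was broadcast one hop
earlier by a node that it also hears (`known_after_hop`). This has to be started at the first hop:
* if `d ≤ r - 1`, every receiver has the file of one of the two summands;
* if `d ≥ 2 r - 1`, the two symbols are first sent separately, at the cost of one more symbol;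
* in between, streams with `(u / B) % d < r - 1` have a first hop of length `r - 1`, within which
  receivers have one of the two files, and `d ≤ 2 (r - 1)` suffices to separate the sums of the second
  hop. The first hop can be that short because the last hop of such a stream has slack. The other
  streams, a fraction `(d - (r - 1)) / d` of them, start uncoded.

So `B T` is the number of streams that start uncoded plus `∑ (u / (B d) + 1)` over all streams
(`achievable_streams`). With `U` streams and `D = B d`, the inner quotients sum to at most
`U² / (2 D) - U / 2 + D / 8` (`sum_div_le`), which gives `n² / (8 d) + n / 4` up to the remainder, while the
uncoded streams add `0`, `n / 2 * (d - (r - 1)) / d` and `n / 2` in the three regimes. These are the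
coefficients of `n = N - r` in `loadExpr`. The bound by a multiple of `loadExpr` follows from
`loadExpr ≥ n² / (8 d) + n / 8` (`le_loadExpr`).
-/

namespace RingComputing

/-! ### Schemes from message families -/

/-- It suffices to name the broadcast messages as functions of all intermediate values, provided
that each of them, and the desired outputs, are determined by what the node in question knows:
encoders and decoders then exist by choice. -/
theorem exists_scheme {N d B : ℕ} {K : Type*} {M : ZMod N → Finset (ZMod N)} (ticks : ℕ)
    (len : ℕ → ZMod N → ℕ) (F : (t : ℕ) → (k : ZMod N) → IVArray N B K → Fin (len t k) → K)
    [Nonempty K]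
    (henc : ∀ t k v v', (∀ i ∈ M k, v i = v' i) →
      (∀ s < t, ∀ m ∈ neighbors N d k, F s m v = F s m v') → F t k v = F t k v')
    (hdec : ∀ k v v', (∀ i ∈ M k, v i = v' i) →
      (∀ s < ticks, ∀ m ∈ neighbors N d k, F s m v = F s m v') → ∀ i, v i k = v' i k) :
    ∃ S : Scheme N d B K M, S.ticks = ticks ∧ S.len = len ∧
      ∀ v k i, S.decoded v k i = v i k := by
  classical
  let loc (k) (v : IVArray N B K) : LocalIVs N B K M k := fun i => v i.1
  let heard (t k) (v : IVArray N B K) : Received N d K len t k := fun s m => F s m.1 v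
  have henc' : ∀ t k, ∃ e : LocalIVs N B K M k → Received N d K len t k → Fin (len t k) → K,
      ∀ v, e (loc k v) (heard t k v) = F t k v := by
    intro t k
    refine ⟨fun l ρ => if h : ∃ v, loc k v = l ∧ heard t k v = ρ then F t k h.choose
      else fun _ => Classical.arbitrary K, fun v => ?_⟩
    have h : ∃ v', loc k v' = loc k v ∧ heard t k v' = heard t k v := ⟨v, rfl, rfl⟩
    simp only [dif_pos h]
    exact henc t k _ _ (fun i hi => congrFun h.choose_spec.1 ⟨i, hi⟩)
      fun s hs m hm => congrFun (congrFun h.choose_spec.2 ⟨s, hs⟩) ⟨m, hm⟩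
  have hdec' : ∀ k, ∃ e : LocalIVs N B K M k → Received N d K len ticks k → ZMod N → Fin B → K,
      ∀ v, e (loc k v) (heard ticks k v) = fun i => v i k := by
    intro k
    refine ⟨fun l ρ => if h : ∃ v, loc k v = l ∧ heard ticks k v = ρ then fun i => h.choose i k
      else fun _ _ => Classical.arbitrary K, fun v => ?_⟩
    have h : ∃ v', loc k v' = loc k v ∧ heard ticks k v' = heard ticks k v := ⟨v, rfl, rfl⟩
    simp only [dif_pos h]
    exact funext <| hdec k _ _ (fun i hi => congrFun h.choose_spec.1 ⟨i, hi⟩)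
      fun s hs m hm => congrFun (congrFun h.choose_spec.2 ⟨s, hs⟩) ⟨m, hm⟩
  choose e he using henc'
  choose δ hδ using hdec'
  let S : Scheme N d B K M := ⟨ticks, len, e, δ⟩
  have hmsg : ∀ v t k, S.msg v t k = F t k v := by
    intro v t
    induction t using Nat.strong_induction_on with
    | _ t ih =>
      intro k
      rw [Scheme.msg, ← he t k v]
      exact congrArg (e t k (loc k v)) (funext fun s => funext fun m => ih s s.isLt m.1)
  refine ⟨S, rfl, rfl, fun v k i => ?_⟩
  have := congrArg (δ k (loc k v)) (funext fun s => funext fun m => hmsg v s.1 m.1 :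
    (fun s m => S.msg v s.1 m.1 : Received N d K len ticks k) = heard ticks k v)
  exact congrFun (this.trans (hδ k v)) i

/-! ### Streams, relays and their messages -/

section Streams

variable {N B : ℕ} {K : Type*}

/-- The number of streams, `⌈(N - r) B / 2⌉`. Stream `u` carries, for every node `a`, one symbol
from `a` to `a - (u / B + 1)` and one from `a` to `a + (u / B + 1)`. Together the streams serve the
`(N - r) B` symbols that a node lacks, each along a shortest route. -/
def numStreams (N r B : ℕ) : ℕ := ((N - r) * B + 1) / 2

/-- The symbol that stream `u` moves downwards, starting at node `a`; it is computed from the last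
file of `a`, of which `a` is the lowest holder. -/
def downSymbol [NeZero B] (r u : ℕ) (a : ZMod N) (v : IVArray N B K) : K :=
  v (a + r - 1) (a - ((u / B + 1 : ℕ) : ZMod N)) (Fin.ofNat B u)

/-- The symbol that stream `u` moves upwards, starting at node `a`; it is computed from the first
file of `a`, of which `a` is the highest holder. Symbols are numbered in reverse, so that the
two directions of a stream between them use every symbol of a packet exactly once, except that
for odd `(N - r) B` the two directions of the last stream carry the same symbol. -/
def upSymbol [NeZero B] (u : ℕ) (a : ZMod N) (v : IVArray N B K) : K :=
  v a (a + ((u / B + 1 : ℕ) : ZMod N)) (Fin.ofNat B u).rev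

/-- A stream is coded if already its first hop is shared by the two directions. -/
def Coded (r d B u : ℕ) : Prop := d ≤ 2 * (r - 1) ∧ u / B % d + 1 ≤ r - 1

open Classical in
/-- The length of the first hop of a stream. All further hops have length `d`, with the possible
exception of the last one. -/
noncomputable def firstHop (r d B u : ℕ) : ℕ := if Coded r d B u then min d (r - 1) else d

/-- The distance covered by the symbols of a stream that have made `t` hops, the first one of
length `f`. -/
def shift (d f : ℕ) : ℕ → ℕ
  | 0 => 0
  | t + 1 => f + t * d

open Classical in
/-- The streams served at a clock tick: the uncoded ones at tick `0`, and at tick `t + 1` those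
which need at least `t + 1` hops. -/
noncomputable def slots (N r d B : ℕ) : ℕ → Finset ℕ
  | 0 => (Finset.range (numStreams N r B)).filter fun u => ¬ Coded r d B u
  | t + 1 => (Finset.range (numStreams N r B)).filter fun u => t ≤ u / (B * d)

/-- The symbol that node `m` broadcasts for stream `u`: at tick `0` its own upward symbol, and at
tick `t + 1` the sum of the two symbols that have reached `m` after `t` hops. -/
noncomputable def symbol [NeZero B] [Add K] (r d u : ℕ) (m : ZMod N) (v : IVArray N B K) : ℕ → K
  | 0 => upSymbol u m v
  | t + 1 => downSymbol r u (m + (shift d (firstHop r d B u) t : ZMod N)) v +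
      upSymbol u (m - (shift d (firstHop r d B u) t : ZMod N)) v

end Streams

/-! ### What a node knows -/

/-- The propagation of knowledge, seen from a node at the origin: `P z` and `Q z` say that it knows
the downward and the upward symbol which start at `z`. If it hears the sums broadcast within
distance `d`, then after every hop it knows both summands: of a sum broadcast above it, the
upward summand was broadcast one hop before by a node which it also hears, and likewise below. -/
theorem known_after_hop {d r f T : ℕ} {P Q : ℤ → Prop}
    (hP : ∀ z : ℤ, -(r : ℤ) < z → z ≤ 0 → P z) (hQ : ∀ z : ℤ, 0 ≤ z → z < r → Q z)
    (hdf : d < f + r) (h0 : ∀ z : ℤ, |z| ≤ f → P z ∧ Q z)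
    (hsum : ∀ j < T, ∀ z : ℤ, z ≠ 0 → |z| ≤ d →
      (P (z + (f + j * d : ℕ)) ↔ Q (z - (f + j * d : ℕ)))) :
    ∀ j < T, ∀ z : ℤ, |z| ≤ d → P (z + (f + j * d : ℕ)) ∧ Q (z - (f + j * d : ℕ)) := by
  intro j
  induction j with
  | zero =>
    intro hj z hz
    have hz' := abs_le.1 hz
    have hsum' := hsum 0 hj z
    simp only [zero_mul, add_zero] at hsum' ⊢
    have hq : 0 ≤ z → Q (z - f) := by
      intro h
      rcases le_or_gt (f : ℤ) z with h1 | h1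
      · exact hQ _ (by omega) (by omega)
      · exact (h0 _ (abs_le.2 ⟨by omega, by omega⟩)).2
    have hp : z ≤ 0 → P (z + f) := by
      intro h
      rcases le_or_gt z (-(f : ℤ)) with h1 | h1
      · exact hP _ (by omega) (by omega)
      · exact (h0 _ (abs_le.2 ⟨by omega, by omega⟩)).1
    rcases lt_trichotomy z 0 with h | h | h
    · exact ⟨hp h.le, (hsum' h.ne hz).1 (hp h.le)⟩
    · exact ⟨hp h.le, hq h.ge⟩
    · exact ⟨(hsum' h.ne' hz).2 (hq h.le), hq h.le⟩
  | succ j ih =>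
    intro hj z hz
    have hz' := abs_le.1 hz
    have hsum' := hsum (j + 1) hj z
    have hq : 0 ≤ z → Q (z - (f + (j + 1) * d : ℕ)) := by
      intro h
      convert (ih (by omega) (z - d) (abs_le.2 ⟨by omega, by omega⟩)).2 using 1
      push_cast
      ring
    have hp : z ≤ 0 → P (z + (f + (j + 1) * d : ℕ)) := by
      intro h
      convert (ih (by omega) (z + d) (abs_le.2 ⟨by omega, by omega⟩)).1 using 1
      push_cast
      ring
    rcases lt_trichotomy z 0 with h | h | h
    · exact ⟨hp h.le, (hsum' h.ne hz).1 (hp h.le)⟩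
    · exact ⟨hp h.le, hq h.ge⟩
    · exact ⟨(hsum' h.ne' hz).2 (hq h.le), hq h.le⟩

theorem firstHop_le (r d B u : ℕ) : firstHop r d B u ≤ d := by
  unfold firstHop
  split_ifs <;> simp

theorem lt_firstHop_add {r : ℕ} (d B u : ℕ) (hr : 1 ≤ r) : d < firstHop r d B u + r := by
  unfold firstHop
  split_ifs with h
  · have := h.1
    omega
  · omega

theorem mod_lt_firstHop {r d B u : ℕ} (hd : 1 ≤ d) : u / B % d < firstHop r d B u := by
  have h1 := Nat.mod_lt (u / B) hd
  unfold firstHop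
  split_ifs with h
  · have := h.2
    omega
  · exact h1

theorem add_intCast_mem_neighbors {N d : ℕ} (k : ZMod N) {z : ℤ} (hz : z ≠ 0) (hzd : |z| ≤ d) :
    k + (z : ZMod N) ∈ neighbors N d k := by
  have hz' := abs_le.1 hzd
  refine ⟨z.natAbs, by omega, by omega, ?_⟩
  rcases lt_or_gt_of_ne hz with h | h
  · right
    have : z = -(z.natAbs : ℤ) := by omega
    rw [this]
    simp [sub_eq_add_neg]
  · left
    have : z = (z.natAbs : ℤ) := by omega
    rw [this]
    simp

theorem add_mem_cyclicPlacement {N r : ℕ} (k : ZMod N) {z : ℤ} (hz : 0 ≤ z) (hzr : z < r) :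
    k + (z : ZMod N) ∈ cyclicPlacement N r k := by
  lift z to ℕ using hz
  exact Finset.mem_image.2 ⟨z, by simpa using hzr, by simp⟩

section Knowledge

variable {N r d B : ℕ} [NeZero B] {K : Type*} {k : ZMod N} {v v' : IVArray N B K}

theorem downSymbol_eq_of_local (hloc : ∀ i ∈ cyclicPlacement N r k, v i = v' i) (u : ℕ) (z : ℤ)
    (h1 : -(r : ℤ) < z) (h2 : z ≤ 0) :
    downSymbol r u (k + (z : ZMod N)) v = downSymbol r u (k + (z : ZMod N)) v' := by
  have := hloc _ (add_mem_cyclicPlacement k (z := z + r - 1) (by omega) (by omega))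
  unfold downSymbol
  convert congrFun (congrFun this _) _ using 3 <;> push_cast <;> ring

theorem upSymbol_eq_of_local (hloc : ∀ i ∈ cyclicPlacement N r k, v i = v' i) (u : ℕ) (z : ℤ)
    (h1 : 0 ≤ z) (h2 : z < r) :
    upSymbol u (k + (z : ZMod N)) v = upSymbol u (k + (z : ZMod N)) v' :=
  congrFun (congrFun (hloc _ (add_mem_cyclicPlacement k h1 h2)) _) _

/-- A node which hears the sums for stream `u` of the first `j + 1` stages knows the summands
broadcast within distance `d` at stage `j`; at stage `0`, within the length of the first hop. -/
theorem symbols_eq_of_heard [AddGroup K] (hr : 1 ≤ r) {u j : ℕ} (hu : u < numStreams N r B)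
    (hj : j ≤ u / (B * d)) (hloc : ∀ i ∈ cyclicPlacement N r k, v i = v' i)
    (hheard : ∀ t < j + 2, ∀ m ∈ neighbors N d k, ∀ u ∈ slots N r d B t,
      symbol r d u m v t = symbol r d u m v' t) (z : ℤ)
    (hz : |z| ≤ if j = 0 then firstHop r d B u else d) :
    downSymbol r u (k + ((z + shift d (firstHop r d B u) j : ℤ) : ZMod N)) v =
        downSymbol r u (k + ((z + shift d (firstHop r d B u) j : ℤ) : ZMod N)) v' ∧
      upSymbol u (k + ((z - shift d (firstHop r d B u) j : ℤ) : ZMod N)) v =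
        upSymbol u (k + ((z - shift d (firstHop r d B u) j : ℤ) : ZMod N)) v' := by
  set f := firstHop r d B u with hf
  let P : ℤ → Prop := fun z =>
    downSymbol r u (k + (z : ZMod N)) v = downSymbol r u (k + (z : ZMod N)) v'
  let Q : ℤ → Prop := fun z =>
    upSymbol u (k + (z : ZMod N)) v = upSymbol u (k + (z : ZMod N)) v'
  have hP : ∀ z : ℤ, -(r : ℤ) < z → z ≤ 0 → P z := downSymbol_eq_of_local hloc u
  have hQ : ∀ z : ℤ, 0 ≤ z → z < r → Q z := upSymbol_eq_of_local hloc u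
  have hfd : f ≤ d := firstHop_le ..
  have hsum : ∀ i ≤ j, ∀ z : ℤ, z ≠ 0 → |z| ≤ d →
      (P (z + (shift d f i : ℕ)) ↔ Q (z - (shift d f i : ℕ))) := by
    intro i hi z hz hzd
    have := hheard (i + 1) (by omega) _ (add_intCast_mem_neighbors k hz hzd) u
      (by simp only [slots, Finset.mem_filter, Finset.mem_range]; exact ⟨hu, hi.trans hj⟩)
    simp only [symbol, ← hf] at this
    have e1 : k + ((z + (shift d f i : ℕ) : ℤ) : ZMod N) =
        k + (z : ZMod N) + (shift d f i : ZMod N) := by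
      push_cast; ring
    have e2 : k + ((z - (shift d f i : ℕ) : ℤ) : ZMod N) =
        k + (z : ZMod N) - (shift d f i : ZMod N) := by
      push_cast; ring
    simp only [P, Q, e1, e2]
    constructor
    · intro h
      rw [h] at this
      exact add_left_cancel this
    · intro h
      rw [h] at this
      exact add_right_cancel this
  have h0 : ∀ z : ℤ, |z| ≤ f → P z ∧ Q z := by
    intro z hz
    have hz' := abs_le.1 hz
    have hs := hsum 0 (Nat.zero_le _) z
    simp only [shift, Nat.cast_zero, add_zero, sub_zero] at hs
    rcases eq_or_ne z 0 with rfl | hz0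
    · exact ⟨hP 0 (by omega) le_rfl, hQ 0 le_rfl (by omega)⟩
    have hs := hs hz0 (hz.trans (by exact_mod_cast hfd))
    by_cases hc : Coded r d B u
    · have hfr : f ≤ r - 1 := by
        rw [hf, firstHop, if_pos hc]
        exact min_le_right _ _
      rcases lt_or_gt_of_ne hz0 with h | h
      · have := hP z (by omega) h.le
        exact ⟨this, hs.1 this⟩
      · have := hQ z h.le (by omega)
        exact ⟨hs.2 this, this⟩
    · have := hheard 0 (by omega) _
        (add_intCast_mem_neighbors k hz0 (hz.trans (by exact_mod_cast hfd))) u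
        (by simp only [slots, Finset.mem_filter, Finset.mem_range]; exact ⟨hu, hc⟩)
      exact ⟨hs.2 this, this⟩
  rcases j with _ | j
  · simpa [P, Q, shift] using h0 z (by simpa using hz)
  · exact known_after_hop hP hQ (lt_firstHop_add d B u hr) h0
      (fun i hi => hsum (i + 1) hi) j (Nat.lt_succ_self j) z (by simpa using hz)

/-- The message of a node at a clock tick is a function of its files and of what it has heard. -/
theorem symbol_eq_of_heard [AddGroup K] (hr : 1 ≤ r) {u t : ℕ} (hu : u ∈ slots N r d B t)
    (hloc : ∀ i ∈ cyclicPlacement N r k, v i = v' i)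
    (hheard : ∀ s < t, ∀ m ∈ neighbors N d k, ∀ u ∈ slots N r d B s,
      symbol r d u m v s = symbol r d u m v' s) :
    symbol r d u k v t = symbol r d u k v' t := by
  have hp0 := downSymbol_eq_of_local hloc u 0 (by omega) le_rfl
  have hq0 := upSymbol_eq_of_local hloc u 0 le_rfl (by omega)
  simp only [Int.cast_zero, add_zero] at hp0 hq0
  rcases t with _ | _ | j
  · exact hq0
  · simp only [symbol, shift, Nat.cast_zero, add_zero, sub_zero]
    rw [hp0, hq0]
  · simp only [slots, Finset.mem_filter, Finset.mem_range] at hu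
    set f := firstHop r d B u with hf
    -- the symbols to be sent were broadcast one hop before, at distance `g`
    obtain ⟨g, hg, hgs⟩ : ∃ g : ℕ, (g = if j = 0 then f else d) ∧
        shift d f (j + 1) = g + shift d f j := by
      refine ⟨_, rfl, ?_⟩
      rcases j with _ | j
      · simp [shift]
      · simp only [shift, Nat.succ_ne_zero, if_false]
        ring
    have key := symbols_eq_of_heard hr hu.1 (by omega : j ≤ u / (B * d)) hloc hheard
    have h1 := (key g (by rw [← hf, ← hg]; simp)).1
    have h2 := (key (-g) (by rw [← hf, ← hg]; simp)).2
    simp only [symbol, ← hf, hgs] at h1 h2 ⊢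
    have e1 : k + (((g : ℤ) + (shift d f j : ℕ) : ℤ) : ZMod N) =
        k + ((g + shift d f j : ℕ) : ZMod N) := by
      push_cast; ring
    have e2 : k + ((-(g : ℤ) - (shift d f j : ℕ) : ℤ) : ZMod N) =
        k - ((g + shift d f j : ℕ) : ZMod N) := by
      push_cast; ring
    rw [e1] at h1
    rw [e2] at h2
    rw [h1, h2]

/-- At the end a node knows both symbols which a stream carries to it. -/
theorem delivered [AddGroup K] (hr : 1 ≤ r) (hd : 1 ≤ d) {u T : ℕ} (hu : u < numStreams N r B)
    (hT : u / (B * d) + 2 ≤ T) (hloc : ∀ i ∈ cyclicPlacement N r k, v i = v' i)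
    (hheard : ∀ t < T, ∀ m ∈ neighbors N d k, ∀ u ∈ slots N r d B t,
      symbol r d u m v t = symbol r d u m v' t) :
    downSymbol r u (k + ((u / B + 1 : ℕ) : ZMod N)) v =
        downSymbol r u (k + ((u / B + 1 : ℕ) : ZMod N)) v' ∧
      upSymbol u (k - ((u / B + 1 : ℕ) : ZMod N)) v =
        upSymbol u (k - ((u / B + 1 : ℕ) : ZMod N)) v' := by
  have key := symbols_eq_of_heard hr hu le_rfl hloc (fun t ht => hheard t (by omega))
  set f := firstHop r d B u with hf
  have hy : u / B % d < f := mod_lt_firstHop hd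
  have hfd : f ≤ d := firstHop_le ..
  have hx : u / B = d * (u / (B * d)) + u / B % d := by
    rw [← Nat.div_div_eq_div_mul, Nat.div_add_mod]
  obtain ⟨g, hg, hgs⟩ : ∃ g : ℕ, (g ≤ if u / (B * d) = 0 then f else d) ∧
      u / B + 1 = g + shift d f (u / (B * d)) := by
    generalize u / (B * d) = j at hx ⊢
    rcases j with _ | j
    · exact ⟨u / B % d + 1, by simpa using hy, by simp [shift]; simpa using hx⟩
    · refine ⟨u / B % d + 1 + d - f, by simp; omega, ?_⟩
      simp only [shift]
      have : d * (j + 1) = j * d + d := by ring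
      omega
  have hg' : (g : ℤ) ≤ ((if u / (B * d) = 0 then f else d : ℕ) : ℤ) := by exact_mod_cast hg
  have h1 := (key g (by simpa using hg')).1
  have h2 := (key (-g) (by simpa using hg')).2
  rw [hgs]
  have e1 : k + (((g : ℤ) + (shift d f (u / (B * d)) : ℕ) : ℤ) : ZMod N) =
      k + ((g + shift d f (u / (B * d)) : ℕ) : ZMod N) := by
    push_cast; ring
  have e2 : k + ((-(g : ℤ) - (shift d f (u / (B * d)) : ℕ) : ℤ) : ZMod N) =
      k - ((g + shift d f (u / (B * d)) : ℕ) : ZMod N) := by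
    push_cast; ring
  rw [e1] at h1
  rw [e2] at h2
  exact ⟨h1, h2⟩

end Knowledge

/-- The streams between them deliver every symbol of every missing packet. -/
theorem eq_of_delivered {N r B : ℕ} [NeZero N] [NeZero B] {K : Type*} {k : ZMod N}
    {v v' : IVArray N B K} (hrN : r ≤ N) (hloc : ∀ i ∈ cyclicPlacement N r k, v i = v' i)
    (hdel : ∀ u < numStreams N r B,
      downSymbol r u (k + ((u / B + 1 : ℕ) : ZMod N)) v =
        downSymbol r u (k + ((u / B + 1 : ℕ) : ZMod N)) v' ∧
      upSymbol u (k - ((u / B + 1 : ℕ) : ZMod N)) v =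
        upSymbol u (k - ((u / B + 1 : ℕ) : ZMod N)) v') (i : ZMod N) : v i k = v' i k := by
  have hB : 0 < B := NeZero.pos B
  obtain ⟨c, hcN, rfl⟩ : ∃ c < N, i = k + (c : ZMod N) :=
    ⟨(i - k).val, ZMod.val_lt _, by simp⟩
  rcases lt_or_ge c r with hc | hc
  · exact congrFun (hloc _ (Finset.mem_image.2 ⟨c, by simpa using hc, rfl⟩)) k
  obtain ⟨j, rfl⟩ := Nat.exists_eq_add_of_le hc
  obtain ⟨n, rfl⟩ := Nat.exists_eq_add_of_le hrN
  have hN : ((r + n : ℕ) : ZMod (r + n)) = 0 := ZMod.natCast_self _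
  have hj : j + 1 ≤ n := by omega
  funext b
  have hb := b.isLt
  rcases lt_or_ge (B * j + b) (numStreams (r + n) r B) with hu | hu
  · have := (hdel _ hu).1
    have hdiv : (B * j + b) / B = j := by
      rw [Nat.mul_add_div hB, Nat.div_eq_of_lt hb, add_zero]
    have hmod : Fin.ofNat B (B * j + b) = b := by
      ext; simp [Fin.ofNat, Nat.mod_eq_of_lt hb]
    simp only [downSymbol, hdiv, hmod] at this
    convert this using 2 <;> push_cast <;> ring
  · obtain ⟨l, rfl⟩ := Nat.exists_eq_add_of_le hj
    have hlt : B * l + (B - 1 - b) < numStreams (r + (j + 1 + l)) r B := by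
      simp only [numStreams, Nat.add_sub_cancel_left] at hu ⊢
      have : (j + 1 + l) * B = B * j + B + B * l := by ring
      omega
    have := (hdel _ hlt).2
    have hdiv : (B * l + (B - 1 - b)) / B = l := by
      rw [Nat.mul_add_div hB, Nat.div_eq_of_lt (by omega), add_zero]
    have hmod : (Fin.ofNat B (B * l + (B - 1 - b))).rev = b := by
      ext
      simp only [Fin.ofNat, Fin.val_rev, Nat.mul_add_mod]
      rw [Nat.mod_eq_of_lt (by omega)]
      omega
    simp only [upSymbol, hdiv, hmod] at this
    have e : k + ((r + j : ℕ) : ZMod (r + (j + 1 + l))) = k - ((l + 1 : ℕ) : ZMod _) := by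
      rw [eq_sub_iff_add_eq, add_assoc k, ← Nat.cast_add]
      have : r + j + (l + 1) = r + (j + 1 + l) := by ring
      rw [congrArg (Nat.cast : ℕ → ZMod (r + (j + 1 + l))) this, hN, add_zero]
    rw [e]
    convert this using 2 <;> ring

/-! ### The communication load -/

theorem card_slots_sum (N r d B H : ℕ) (hH : numStreams N r B ≤ H) :
    ∑ t ∈ Finset.range (H + 1), (slots N r d B t).card = (slots N r d B 0).card +
      ∑ u ∈ Finset.range (numStreams N r B), (u / (B * d) + 1) := by
  rw [Finset.sum_range_succ', add_comm]
  congr 1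
  simp only [slots, Finset.card_filter]
  rw [Finset.sum_comm]
  refine Finset.sum_congr rfl fun u hu => ?_
  have hu' := Finset.mem_range.1 hu
  have h1 : u / (B * d) ≤ u := Nat.div_le_self _ _
  rw [← Finset.card_filter]
  have : (Finset.range H).filter (fun t => t ≤ u / (B * d)) = Finset.range (u / (B * d) + 1) := by
    ext t
    simp only [Finset.mem_filter, Finset.mem_range]
    omega
  rw [this, Finset.card_range]

/-- The load achieved: `N B` times it is the number of streams that start uncoded plus the number
of hops of all streams, for each of the `N` nodes. -/
theorem achievable_streams {N r d B : ℕ} [NeZero N] (K : Type*) [AddGroup K] (hr : 1 ≤ r)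
    (hrN : r ≤ N) (hd : 1 ≤ d) (hB : 1 ≤ B) :
    AchievableNCL N d B K (cyclicPlacement N r)
      ((((slots N r d B 0).card : ℝ) +
        ∑ u ∈ Finset.range (numStreams N r B), (((u / (B * d) : ℕ) : ℝ) + 1)) / B) := by
  have : NeZero B := ⟨by omega⟩
  let H := numStreams N r B
  let F : (t : ℕ) → ZMod N → IVArray N B K → Fin (slots N r d B t).card → K :=
    fun t m v c => symbol r d ((slots N r d B t).equivFin.symm c).1 m v t
  have hF : ∀ t m v v', F t m v = F t m v' ↔
      ∀ u ∈ slots N r d B t, symbol r d u m v t = symbol r d u m v' t := by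
    intro t m v v'
    constructor
    · intro h u hu
      simpa [F] using congrFun h ((slots N r d B t).equivFin ⟨u, hu⟩)
    · intro h
      funext c
      exact h _ ((slots N r d B t).equivFin.symm c).2
  obtain ⟨S, hticks, hlen, hS⟩ := exists_scheme (N := N) (d := d) (B := B) (K := K)
    (M := cyclicPlacement N r) (H + 1) (fun t _ => (slots N r d B t).card) F
    (by
      intro t k v v' hloc hh
      rw [hF]
      intro u hu
      exact symbol_eq_of_heard hr hu hloc fun s hs m hm => (hF s m v v').1 (hh s hs m hm))
    (by
      intro k v v' hloc hh
      refine eq_of_delivered hrN hloc fun u hu => ?_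
      have : u / (B * d) ≤ u := Nat.div_le_self _ _
      exact delivered hr hd hu (T := H + 1) (by omega) hloc
        fun s hs m hm => (hF s m v v').1 (hh s hs m hm))
  refine ⟨S, fun L g w k i => hS _ k i, ?_⟩
  have hN : (N : ℝ) ≠ 0 := NeZero.ne _
  have hc : (∑ t ∈ Finset.range (H + 1), ((slots N r d B t).card : ℝ)) =
      ((slots N r d B 0).card : ℝ) +
        ∑ u ∈ Finset.range (numStreams N r B), (((u / (B * d) : ℕ) : ℝ) + 1) := by
    exact_mod_cast card_slots_sum N r d B H le_rfl
  rw [← hc]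
  simp only [Scheme.ncl, hticks, hlen, Finset.sum_const, Finset.card_univ, ZMod.card,
    nsmul_eq_mul, ← Finset.mul_sum]
  rw [mul_div_mul_left _ _ hN]

theorem computationLoad_cyclicPlacement {N r : ℕ} [NeZero N] (hrN : r ≤ N) :
    computationLoad N (cyclicPlacement N r) = r := by
  have hN : (N : ℝ) ≠ 0 := NeZero.ne _
  have hcard : ∀ k, (cyclicPlacement N r k).card = r := by
    intro k
    rw [cyclicPlacement, Finset.card_image_of_injOn, Finset.card_range]
    intro a ha b hb h
    simp only [Finset.coe_range, Set.mem_Iio] at ha hb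
    have := congrArg ZMod.val (add_left_cancel h)
    rwa [ZMod.val_natCast_of_lt (by omega), ZMod.val_natCast_of_lt (by omega)] at this
  simp only [computationLoad, hcard, Finset.sum_const, Finset.card_univ, ZMod.card, nsmul_eq_mul]
  field_simp

/-! ### Estimates -/

theorem two_mul_sum_div {D : ℕ} (a e : ℕ) (he : e ≤ D) :
    2 * ∑ u ∈ Finset.range (D * a + e), ((u / D : ℕ) : ℝ) = D * (a * (a - 1)) + 2 * a * e := by
  induction a generalizing e with
  | zero =>
    rw [Finset.sum_eq_zero]
    · simp
    · intro u hu
      have hu : u < e := by simpa using hu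
      simp [Nat.div_eq_of_lt (hu.trans_le he)]
  | succ a iha =>
    induction e with
    | zero =>
      have := iha D le_rfl
      rw [show D * (a + 1) + 0 = D * a + D by ring, this]
      push_cast
      ring
    | succ e ihe =>
      rw [← add_assoc, Finset.sum_range_succ, mul_add, ihe (by omega),
        Nat.mul_add_div (by omega), Nat.div_eq_of_lt (by omega : e < D)]
      push_cast
      ring

theorem sum_div_le {D : ℕ} (hD : 0 < D) (U : ℕ) :
    ∑ u ∈ Finset.range U, ((u / D : ℕ) : ℝ) ≤ (U : ℝ) ^ 2 / (2 * D) - U / 2 + D / 8 := by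
  have h := two_mul_sum_div (U / D) (U % D) (Nat.mod_lt U hD).le
  have hD' : (0 : ℝ) < D := by exact_mod_cast hD
  have hU : (U : ℝ) = D * (U / D : ℕ) + (U % D : ℕ) := by exact_mod_cast (Nat.div_add_mod U D).symm
  rw [Nat.div_add_mod] at h
  set S := ∑ u ∈ Finset.range U, ((u / D : ℕ) : ℝ)
  generalize ((U / D : ℕ) : ℝ) = a at *
  generalize ((U % D : ℕ) : ℝ) = e at *
  have : (U : ℝ) ^ 2 / (2 * D) - U / 2 + D / 8 - S = (D - 2 * e) ^ 2 / (8 * D) := by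
    rw [show S = (D * (a * (a - 1)) + 2 * a * e) / 2 by linarith, hU]
    field_simp
    ring
  have h2 : 0 ≤ (D - 2 * e) ^ 2 / (8 * D) := by positivity
  linarith

theorem sum_div_le_sq {D : ℕ} (hD : 0 < D) (U : ℕ) :
    ∑ u ∈ Finset.range U, ((u / D : ℕ) : ℝ) ≤ (U : ℝ) ^ 2 / (2 * D) := by
  have hD' : (0 : ℝ) < D := by exact_mod_cast hD
  induction U with
  | zero => simp
  | succ U ih =>
    rw [Finset.sum_range_succ]
    have h1 : ((U / D : ℕ) : ℝ) ≤ U / D := Nat.cast_div_le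
    have h2 : ((U + 1 : ℕ) : ℝ) ^ 2 / (2 * D) = (U : ℝ) ^ 2 / (2 * D) + U / D + 1 / (2 * D) := by
      push_cast
      field_simp
      ring
    have h3 : (0 : ℝ) ≤ 1 / (2 * D) := by positivity
    linarith

theorem card_filter_mod_le {D : ℕ} (c a e : ℕ) (he : e ≤ D) :
    ((Finset.range (D * a + e)).filter fun u => c ≤ u % D).card ≤ a * (D - c) + (e - c) := by
  induction a generalizing e with
  | zero =>
    have : ((Finset.range (D * 0 + e)).filter fun u => c ≤ u % D) ⊆ Finset.Ico c e := by
      intro u hu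
      simp only [Finset.mem_filter, Finset.mem_range, mul_zero, zero_add] at hu
      rw [Nat.mod_eq_of_lt (by omega)] at hu
      exact Finset.mem_Ico.2 ⟨hu.2, hu.1⟩
    simpa using Finset.card_le_card this
  | succ a iha =>
    induction e with
    | zero =>
      have := iha D le_rfl
      rw [show D * (a + 1) + 0 = D * a + D by ring]
      rw [add_mul]
      omega
    | succ e ihe =>
      have := ihe (by omega)
      rw [← add_assoc, Finset.range_add_one, Finset.filter_insert, Nat.mul_add_mod,
        Nat.mod_eq_of_lt (by omega : e < D)]
      split_ifs with h
      · have h2 := Finset.card_insert_le (D * (a + 1) + e)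
          ((Finset.range (D * (a + 1) + e)).filter fun u => c ≤ u % D)
        omega
      · omega

open Classical in
theorem card_uncoded_of_le {N r d B : ℕ} (hd : 1 ≤ d) (h : d ≤ r - 1) :
    (slots N r d B 0).card = 0 := by
  refine Finset.card_eq_zero.2 (Finset.eq_empty_of_forall_notMem fun u hu => ?_)
  have := Nat.mod_lt (u / B) hd
  exact (Finset.mem_filter.1 hu).2 ⟨by omega, by omega⟩

open Classical in
theorem card_uncoded_le (N r d B : ℕ) : (slots N r d B 0).card ≤ numStreams N r B :=
  (Finset.card_filter_le _ _).trans (Finset.card_range _).le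

/-- In the middle regime `D = B * d` consecutive streams contain `B * (d - (r - 1))` uncoded ones. -/
theorem card_uncoded_le_of_le {N r d B : ℕ} (hB : 1 ≤ B) (hd : 1 ≤ d)
    (hrd : r - 1 ≤ d) (h : d ≤ 2 * (r - 1)) :
    ((slots N r d B 0).card : ℝ) ≤
      (numStreams N r B : ℝ) / d * (d - (r - 1 : ℕ)) + B * d := by
  have hD : 0 < B * d := Nat.mul_pos hB hd
  set U := numStreams N r B with hU
  have hsub : slots N r d B 0 ⊆ (Finset.range U).filter fun u => B * (r - 1) ≤ u % (B * d) := by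
    intro u hu
    simp only [slots, Finset.mem_filter, Finset.mem_range, Coded, not_and, not_le] at hu ⊢
    refine ⟨hu.1, ?_⟩
    have h1 := hu.2 h
    rw [← Nat.mod_mul_right_div_self] at h1
    have h2 : r - 1 ≤ u % (B * d) / B := by omega
    rw [Nat.le_div_iff_mul_le (by omega)] at h2
    linarith
  have h1 := (Finset.card_le_card hsub).trans
    (by simpa only [Nat.div_add_mod] using
      card_filter_mod_le (B * (r - 1)) (U / (B * d)) (U % (B * d)) (Nat.mod_lt U hD).le)
  have h2 : (slots N r d B 0).card ≤ U / (B * d) * (B * (d - (r - 1))) + B * d := by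
    rw [Nat.mul_sub]
    have := Nat.mod_lt U hD
    omega
  have h3 : ((slots N r d B 0).card : ℝ) ≤
      ((U / (B * d) : ℕ) : ℝ) * (B * (d - (r - 1 : ℕ))) + B * d := by
    rw [← Nat.cast_sub hrd]
    exact_mod_cast h2
  have h4 : ((U / (B * d) : ℕ) : ℝ) ≤ U / ((B * d : ℕ) : ℝ) := Nat.cast_div_le
  have hB' : (0 : ℝ) < B := by exact_mod_cast hB
  have hd' : (0 : ℝ) < d := by exact_mod_cast hd
  have h5 : (0 : ℝ) ≤ d - (r - 1 : ℕ) := by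
    rw [sub_nonneg]
    exact_mod_cast hrd
  refine h3.trans (add_le_add_left ?_ _)
  calc _ ≤ (U : ℝ) / ((B * d : ℕ) : ℝ) * (B * (d - (r - 1 : ℕ))) := by gcongr
    _ = _ := by
      push_cast
      field_simp

theorem loadExpr_of_le {N r d : ℕ} (hd : 1 ≤ d) (h : (d : ℤ) ≤ r - 1) :
    loadExpr N r d = ((N : ℝ) - r) ^ 2 / (8 * d) + ((N : ℝ) - r) / 4 := by
  have hd' : (d : ℝ) ≠ 0 := by exact_mod_cast (by omega : d ≠ 0)
  rw [loadExpr, if_pos h]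
  field_simp
  ring

theorem loadExpr_of_lt_of_le {N r d : ℕ} (hd : 1 ≤ d) (h : ¬ (d : ℤ) ≤ r - 1)
    (h' : (d : ℤ) ≤ 2 * (r - 1)) :
    loadExpr N r d = ((N : ℝ) - r) ^ 2 / (8 * d) +
      ((N : ℝ) - r) * (1 / 4 + (d - (r - 1)) / (2 * d)) - r * (d - r) / (2 * d) + 1 / (2 * d) := by
  have hd' : (d : ℝ) ≠ 0 := by exact_mod_cast (by omega : d ≠ 0)
  rw [loadExpr, if_neg h, if_pos h']
  field_simp
  ring

theorem loadExpr_of_gt {N r d : ℕ} (hd : 1 ≤ d) (hr : 1 ≤ r) (h : ¬ (d : ℤ) ≤ 2 * (r - 1)) :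
    loadExpr N r d = ((N : ℝ) - r) ^ 2 / (8 * d) + 3 * ((N : ℝ) - r) / 4 := by
  have hd' : (d : ℝ) ≠ 0 := by exact_mod_cast (by omega : d ≠ 0)
  rw [loadExpr, if_neg (by omega), if_neg h]
  field_simp
  ring

theorem mul_sub_div_le {r d : ℕ} (hd : 1 ≤ d) : (r : ℝ) * (d - r) / (2 * d) ≤ d / 8 := by
  have hd' : (0 : ℝ) < d := by exact_mod_cast hd
  rw [div_le_div_iff₀ (by positivity) (by norm_num)]
  nlinarith [sq_nonneg ((d : ℝ) - 2 * r)]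

/-- In the middle regime the negative term of `loadExpr` is at most `d / 8`, hence at most
`(N - r) / 8` because `d + r ≤ 2 * d ≤ N`. -/
theorem le_loadExpr {N r d : ℕ} (hr : 1 ≤ r) (hrN : r ≤ N) (hd : 1 ≤ d) (hdN : d ≤ N / 2) :
    ((N : ℝ) - r) ^ 2 / (8 * d) + ((N : ℝ) - r) / 8 ≤ loadExpr N r d := by
  have hn : (0 : ℝ) ≤ N - r := sub_nonneg.2 (by exact_mod_cast hrN)
  have hd' : (0 : ℝ) < d := by exact_mod_cast hd
  by_cases h1 : (d : ℤ) ≤ r - 1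
  · rw [loadExpr_of_le hd h1]
    linarith
  by_cases h2 : (d : ℤ) ≤ 2 * (r - 1)
  · rw [loadExpr_of_lt_of_le hd h1 h2]
    have h3 := mul_sub_div_le (r := r) hd
    have hdr : (r : ℝ) ≤ d := by exact_mod_cast (by omega : r ≤ d)
    have h4 : (0 : ℝ) ≤ ((N : ℝ) - r) * ((d - (r - 1)) / (2 * d)) :=
      mul_nonneg hn (div_nonneg (by linarith) (by positivity))
    have h5 : (d : ℝ) ≤ N - r := by
      have : (d : ℝ) + r ≤ N := by exact_mod_cast (by omega : d + r ≤ N)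
      linarith
    have h6 : (0 : ℝ) ≤ 1 / (2 * d) := by positivity
    linarith
  · rw [loadExpr_of_gt hd hr h2]
    linarith

end RingComputing

open RingComputing in
theorem theorem2 :
    ∃ C : ℝ, 0 < C ∧
      ∀ (N r d B : ℕ) [NeZero N] (K : Type*) [Field K] [Finite K],
        1 ≤ r → r ≤ N → 1 ≤ d → d ≤ N / 2 → 1 ≤ B →
          RingComputing.computationLoad N (RingComputing.cyclicPlacement N r) = r ∧
          ∃ T : ℝ,
            RingComputing.AchievableNCL N d B K (RingComputing.cyclicPlacement N r) T ∧
            T ≤ C * RingComputing.loadExpr N r d ∧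
            T ≤ RingComputing.loadExpr N r d + C * ((d : ℝ) + (N : ℝ) / (d * B)) := by
  refine ⟨16, by norm_num, ?_⟩
  intro N r d B _ K _ _ hr hrN hd hdN hB
  refine ⟨computationLoad_cyclicPlacement hrN, _, achievable_streams K hr hrN hd hB, ?_⟩
  have hB' : (1 : ℝ) ≤ B := by exact_mod_cast hB
  have hB0 : (0 : ℝ) < B := by linarith
  have hd1 : (1 : ℝ) ≤ d := by exact_mod_cast hd
  have hd0 : (0 : ℝ) < d := by linarith
  have hD : 0 < B * d := Nat.mul_pos hB hd
  have hE := le_loadExpr hr hrN hd hdN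
  have hdN' : 2 * (d : ℝ) ≤ N := by exact_mod_cast (by omega : 2 * d ≤ N)
  have hs1 := sum_div_le hD (numStreams N r B)
  have hs2 := sum_div_le_sq hD (numStreams N r B)
  have hcU : ((slots N r d B 0).card : ℝ) ≤ numStreams N r B := by
    exact_mod_cast card_uncoded_le N r d B
  have hU1 : (numStreams N r B : ℝ) ≤ (((N : ℝ) - r) * B + 1) / 2 := by
    rw [← Nat.cast_sub hrN, le_div_iff₀ two_pos]
    exact_mod_cast (by unfold numStreams; omega : numStreams N r B * 2 ≤ (N - r) * B + 1)
  have hU2 : (numStreams N r B : ℝ) ≤ ((N : ℝ) - r) * B := by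
    rw [← Nat.cast_sub hrN]
    exact_mod_cast (by unfold numStreams; omega : numStreams N r B ≤ (N - r) * B)
  have hU0 : (0 : ℝ) ≤ numStreams N r B := Nat.cast_nonneg _
  rw [Finset.sum_add_distrib, Finset.sum_const, Finset.card_range, nsmul_eq_mul, mul_one]
  have hcase1 := card_uncoded_of_le (N := N) (r := r) (B := B) hd
  have hcase2 := card_uncoded_le_of_le (N := N) (r := r) hB hd
  push_cast at hs1 hs2
  generalize (∑ u ∈ Finset.range (numStreams N r B), ((u / (B * d) : ℕ) : ℝ)) = S at *
  generalize (numStreams N r B : ℝ) = U at *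
  have hn : (0 : ℝ) ≤ N - r := sub_nonneg.2 (by exact_mod_cast hrN)
  have hnN : (N : ℝ) - r ≤ N := by simp
  set n : ℝ := (N : ℝ) - r with hndef
  constructor
  · have h1 : U ^ 2 / (2 * (B * d)) ≤ (n * B) ^ 2 / (2 * (B * d)) := by gcongr
    rw [div_le_iff₀ hB0]
    have h2 : (n * B) ^ 2 / (2 * (B * d)) = 4 * (n ^ 2 / (8 * d)) * B := by
      field_simp
      ring
    have h3 : (0 : ℝ) ≤ n ^ 2 / (8 * d) * B := by positivity
    nlinarith [mul_le_mul_of_nonneg_right hE hB0.le]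
  · -- the parts of the load that do not depend on the regime
    have hsq : U ^ 2 / (2 * (B * d)) ≤ ((n * B + 1) / 2) ^ 2 / (2 * (B * d)) := by gcongr
    have hsq' : ((n * B + 1) / 2) ^ 2 / (2 * (B * d)) / B =
        n ^ 2 / (8 * d) + n / (d * B) / 4 + 1 / (d * B) / B / 8 := by
      field_simp
      ring
    have hq : (0 : ℝ) ≤ 1 / (d * B) := by positivity
    have h1 : 1 / (d * B) / B ≤ 1 / ((d : ℝ) * B) := div_le_self hq hB'
    have h2 : 1 / ((d : ℝ) * B) ≤ N / (d * B) := by gcongr; linarith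
    have h3 : n / ((d : ℝ) * B) ≤ N / (d * B) := by gcongr
    have h4 : 1 / (B : ℝ) ≤ N / (d * B) := by
      rw [div_le_div_iff₀ hB0 (by positivity)]
      nlinarith
    have hbase : (S + U) / B ≤ n ^ 2 / (8 * d) + n / 4 + d / 8 + N / (d * B) := by
      have : S + U ≤ ((n * B + 1) / 2) ^ 2 / (2 * (B * d)) + (n * B + 1) / 4 + B * d / 8 := by
        linarith
      calc (S + U) / B ≤ _ := div_le_div_of_nonneg_right this hB0.le
        _ = ((n * B + 1) / 2) ^ 2 / (2 * (B * d)) / B + n / 4 + 1 / B / 4 + d / 8 := by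
          field_simp
          ring
        _ ≤ _ := by rw [hsq']; linarith
    have hsplit : (((slots N r d B 0).card : ℝ) + (S + U)) / B =
        ((slots N r d B 0).card : ℝ) / B + (S + U) / B := add_div _ _ _
    rw [hsplit]
    have hR : (0 : ℝ) ≤ N / (d * B) := hq.trans h2
    by_cases c1 : (d : ℤ) ≤ r - 1
    · rw [loadExpr_of_le hd c1, hcase1 (by omega)]
      simp only [Nat.cast_zero, zero_div]
      linarith
    by_cases c2 : (d : ℤ) ≤ 2 * (r - 1)
    · rw [loadExpr_of_lt_of_le hd c1 c2]
      have h5 := hcase2 (by omega) (by omega)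
      rw [Nat.cast_sub hr, Nat.cast_one] at h5
      have hdr : (r : ℝ) ≤ d := by exact_mod_cast (by omega : r ≤ d)
      have hr1 : (1 : ℝ) ≤ r := by exact_mod_cast hr
      have h6 : ((slots N r d B 0).card : ℝ) / B ≤
          n * ((d - (r - 1)) / (2 * d)) + 1 / B / 2 + d := by
        have h7 : U / d * (d - (r - 1)) ≤ (n * B + 1) / 2 / d * (d - (r - 1)) :=
          mul_le_mul_of_nonneg_right (by gcongr) (by linarith)
        have h8 : ((d : ℝ) - (r - 1)) / d ≤ 1 := by
          rw [div_le_one hd0]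
          linarith
        calc _ ≤ ((n * B + 1) / 2 / d * (d - (r - 1)) + B * d) / B :=
              div_le_div_of_nonneg_right (by linarith) hB0.le
          _ = n * ((d - (r - 1)) / (2 * d)) + 1 / B / 2 * ((d - (r - 1)) / d) + d := by
            field_simp
          _ ≤ _ := by
            have := mul_le_mul_of_nonneg_left h8 (by positivity : (0 : ℝ) ≤ 1 / B / 2)
            linarith
      have h7 := mul_sub_div_le (r := r) hd
      have h8 : (0 : ℝ) ≤ 1 / (2 * d) := by positivity
      linarith
    · rw [loadExpr_of_gt hd hr c2]
      have h5 : ((slots N r d B 0).card : ℝ) / B ≤ n / 2 + 1 / B / 2 := by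
        calc _ ≤ (n * B + 1) / 2 / B := div_le_div_of_nonneg_right (by linarith) hB0.le
          _ = _ := by field_simp
      linarith
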